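/- For $f\in C([-1,1]^2,\mathbb R)$ let $\|f\|_\infty=\max_{[-1,1]^2}|f|$, and let $T_k$ be the Chebyshev polynomial of the first kind of degree $k$. For an integer $n\ge 1$: * let $\Pi_n^{[t]}$ and $\Pi_n^{[m]}$ be the spaces of real polynomials in two variables of total degree at most $n$ and of maximal degree at most $n$ (degree at most $n$ in each variable), respectively; * let the Padua points of degree $n$ be the self-intersections and the boundary contacts of the curve $\{(x,y)\in[-1,1]^2 : T_n(x)-T_{n+1}(y)=0\}$, that is, the points of the curve at which both partial derivatives of $T_n(x)-T_{n+1}(y)$ vanish and the points of the curve on the boundary of the square; * let the tensor product Chebyshev grid of degree $n$ be $\{(\cos(j\pi/n),\cos(k\pi/n)) : 0\le j,k\le n\}$. **Theorem.** (Total degree) There is a sequence $(\varepsilon_n)_{n\ge1}$ of real numbers with $\varepsilon_n=O(\log^2 n)$ as $n\to\infty$ such that for every $n\ge1$ and every continuous $\alpha:[-1,1]^2\to\mathbb R$: there is exactly one $\alpha_n^{[t]}\in\Pi_n^{[t]}$ that agrees with $\alpha$ at the Padua points of degree $n$, there is a best approximation of $\alpha$ from $\Pi_n^{[t]}$ in $\|\cdot\|_\infty$,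 and every such best approximation $\alpha_n^{[t]\star}$ satisfies $$\|\alpha-\alpha_n^{[t]}\|_\infty\le(1+\varepsilon_n)\,\|\alpha-\alpha_n^{[t]\star}\|_\infty .$$ (Maximal degree) Likewise, there is a sequence $(\varepsilon_n)_{n\ge1}$ with $\varepsilon_n=O(\log^2 n)$ as $n\to\infty$ such that for every $n\ge1$ and every continuous $\alpha:[-1,1]^2\to\mathbb R$: there is exactly one $\alpha_n^{[m]}\in\Pi_n^{[m]}$ that agrees with $\alpha$ on the tensor product Chebyshev grid of degree $n$, there is a best approximation of $\alpha$ from $\Pi_n^{[m]}$ in $\|\cdot\|_\infty$, and every such best approximation $\alpha_n^{[m]\star}$ satisfies $$\|\alpha-\alpha_n^{[m]}\|_\infty\le(1+\varepsilon_n)\,\|\alpha-\alpha_n^{[m]\star}\|_\infty .$$ -/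

import Mathlib

open Filter Asymptotics

noncomputable section

namespace NearBest

/-- The square `[-1,1]²`, with points written as functions `Fin 2 → ℝ`. It is compact, so the norm
on `C(Square, ℝ)` is the sup-norm. -/
abbrev Square : Set (Fin 2 → ℝ) := Set.Icc (fun _ => -1) (fun _ => 1)

/-- The function on the square defined by a bivariate real polynomial. -/
def polyFun (p : MvPolynomial (Fin 2) ℝ) : C(Square, ℝ) where
  toFun ω := MvPolynomial.eval (ω : Fin 2 → ℝ) p
  continuous_toFun := (MvPolynomial.continuous_eval p).comp continuous_subtype_val

/-- The polynomial `T_n(x) - T_{n+1}(y)`, whose zero set in the square is the generating curve of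
the Padua points of degree `n`. -/
def generatingPoly (n : ℕ) : MvPolynomial (Fin 2) ℝ :=
  Polynomial.aeval (MvPolynomial.X 0) (Polynomial.Chebyshev.T ℝ (n : ℤ)) -
    Polynomial.aeval (MvPolynomial.X 1) (Polynomial.Chebyshev.T ℝ ((n : ℤ) + 1))

/-- The point `ω` lies on the generating curve. -/
def OnCurve (n : ℕ) (ω : Fin 2 → ℝ) : Prop :=
  MvPolynomial.eval ω (generatingPoly n) = 0

/-- The curve meets the boundary of the square at `ω`. -/
def IsBoundaryContact (n : ℕ) (ω : Fin 2 → ℝ) : Prop :=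
  OnCurve n ω ∧ ∃ d, |ω d| = 1

/-- The curve crosses itself at `ω`: both first partial derivatives of its equation vanish there.
(At such a point of the square both `T_n` and `T_{n+1}` have an interior extremum with the same
value `1` or `-1`, so the Hessian is indefinite and `ω` is an ordinary double point, at which two
real branches cross.) -/
def IsSelfIntersection (n : ℕ) (ω : Fin 2 → ℝ) : Prop :=
  OnCurve n ω ∧ ∀ d, MvPolynomial.eval ω (MvPolynomial.pderiv d (generatingPoly n)) = 0

/-- The Padua points of degree `n ≥ 1`: the self-intersections and the boundary contacts of the
generating curve `T_n(x) - T_{n+1}(y) = 0` in the square. -/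
def paduaPoints (n : ℕ) : Set Square :=
  {ω | IsSelfIntersection n ω ∨ IsBoundaryContact n ω}

/-- The tensor product Chebyshev grid of degree `n ≥ 1`: both coordinates are among the `n + 1`
Chebyshev points `cos (j π / n)`, `0 ≤ j ≤ n`. -/
def chebyshevGrid (n : ℕ) : Set Square :=
  {ω | ∀ d, ∃ j ≤ n, (ω : Fin 2 → ℝ) d = Polynomial.Chebyshev.node n j}

/-- `p` is an interpolant of `α` on the nodes `X` from the polynomial space `V`. -/
def IsInterpolant (V : Submodule ℝ (MvPolynomial (Fin 2) ℝ)) (X : Set Square) (α : C(Square, ℝ))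
    (p : MvPolynomial (Fin 2) ℝ) : Prop :=
  p ∈ V ∧ ∀ ω ∈ X, polyFun p ω = α ω

/-- `q` is a best sup-norm approximation of `α` from the polynomial space `V`. -/
def IsBestApprox (V : Submodule ℝ (MvPolynomial (Fin 2) ℝ)) (α : C(Square, ℝ))
    (q : MvPolynomial (Fin 2) ℝ) : Prop :=
  q ∈ V ∧ ∀ r ∈ V, ‖α - polyFun q‖ ≤ ‖α - polyFun r‖

/-- Bivariate real polynomials of total degree at most `n`. -/
abbrev totalDegreeSpace (n : ℕ) : Submodule ℝ (MvPolynomial (Fin 2) ℝ) :=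
  MvPolynomial.restrictTotalDegree (Fin 2) ℝ n

/-- Bivariate real polynomials of maximal degree at most `n`, that is, of degree at most `n` in
each variable. -/
abbrev maximalDegreeSpace (n : ℕ) : Submodule ℝ (MvPolynomial (Fin 2) ℝ) :=
  MvPolynomial.restrictDegree (Fin 2) ℝ n

end NearBest

end

noncomputable section

namespace NearBest

open Real Finset

/-! ### Sums of equispaced sines and cosines -/

/-! Both halves are Lebesgue's lemma (`nearBest_of_lebesgue`). Suppose `‖p‖ ≤ Λ M` for every `p ∈ V`
bounded by `M` on the nodes. Taking `M = 0` makes evaluation at the nodes injective on `V`, and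
since there are at most `dim V` nodes, it is bijective. Applied to `q - p`, with `p` the interpolant
and `q` a best approximation, the bound gives the factor `1 + Λ`. So `ε n` is a bound for the
Lebesgue constant, and the work is to show that it is `O(log² n)`.

Put `x = cos s`, `y = cos t`. Polynomials become cosine polynomials, and the Padua points become the
angles `(jπ/n, kπ/(n+1))` with `j + k` even. Sums run over the whole circle, `2n` by `2(n+1)`
angles, with weight `1 + (-1)^(j+k)`: symmetry then accounts for edges and corners, and the weight
removes the odd nodes. Discrete orthogonality gives a reproducing kernel (`paduaKernel_reproduces`).
The alternating part of the weight contributes nothing, because it shifts the frequencies by `n` and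
`n+1`, and total degree at most `n` prevents both factors from aliasing at once
(`sum_alternating_mul_eq_zero`).

It remains to sum the absolute value of the kernel over the nodes. Up to one bounded term, the
kernel is an average of four translates of the Dirichlet kernel of a triangle, which is dominated by
products of two functions of the form `min(N, 1/|sin(u/2)|)` (`abs_triangleKernel_le`). Each such
function has average `O(log N)` over equispaced nodes (`sum_peak_le`), whence `log²`. On the tensor
grid, the univariate `O(log n)` bound is applied in one variable after the other. -/

/-- A telescoping closed form for sums of cosines of an arithmetic progression. -/
theorem two_mul_sin_mul_sum_cos (P : ℕ) (u β : ℝ) :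
    2 * sin (u / 2) * ∑ j ∈ range P, cos (β + j * u) =
      sin (β + (P - 1 / 2) * u) - sin (β - u / 2) := by
  induction P with
  | zero =>
    simp only [range_zero, sum_empty, Nat.cast_zero, mul_zero]
    rw [show β + (0 - 1 / 2) * u = β - u / 2 by ring, sub_self]
  | succ P ih =>
    rw [sum_range_succ, mul_add, ih]
    have h1 : sin (β + ((P + 1 : ℕ) - 1 / 2) * u) =
        sin (β + P * u) * cos (u / 2) + cos (β + P * u) * sin (u / 2) := by
      rw [← sin_add]; push_cast; ring_nf
    have h2 : sin (β + ((P : ℝ) - 1 / 2) * u) =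
        sin (β + P * u) * cos (u / 2) - cos (β + P * u) * sin (u / 2) := by
      rw [← sin_sub]; ring_nf
    rw [h1, h2]; ring

theorem abs_sum_cos_mul_abs_sin_le (P : ℕ) (u β : ℝ) :
    |∑ j ∈ range P, cos (β + j * u)| * |sin (u / 2)| ≤ 1 := by
  have h := two_mul_sin_mul_sum_cos P u β
  have h1 := abs_sin_le_one (β + (P - 1 / 2) * u)
  have h2 := abs_sin_le_one (β - u / 2)
  rw [← abs_mul, abs_le]
  rw [abs_le] at h1 h2
  constructor <;> linarith [mul_comm (sin (u / 2)) (∑ j ∈ range P, cos (β + j * u))]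

/-- The `j`-th of `P` equispaced angles on the circle. -/
def circleNode (P j : ℕ) : ℝ := j * (2 * π / P)

/-- Aliasing: on `P` equispaced angles the frequency `m` is seen only modulo `P`. -/
theorem sum_cos_circleNode {P : ℕ} (hP : 0 < P) (m : ℤ) :
    ∑ j ∈ range P, cos (m * circleNode P j) = if (P : ℤ) ∣ m then (P : ℝ) else 0 := by
  have hP' : (P : ℝ) ≠ 0 := by positivity
  split_ifs with h
  · obtain ⟨q, rfl⟩ := h
    have : ∀ j ∈ range P, cos (((P * q : ℤ) : ℝ) * circleNode P j) = 1 := by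
      intro j _
      rw [cos_eq_one_iff]
      refine ⟨q * j, ?_⟩
      rw [circleNode]; push_cast; field_simp
    rw [sum_congr rfl this]; simp
  · have key := two_mul_sin_mul_sum_cos P (m * (2 * π / P)) 0
    have hs : sin (m * (2 * π / P) / 2) ≠ 0 := by
      intro h0
      obtain ⟨q, hq⟩ := sin_eq_zero_iff.1 h0
      apply h
      refine ⟨q, ?_⟩
      have : (m : ℝ) = P * q := by
        field_simp at hq
        linarith
      exact_mod_cast this
    have e : sin (0 + (P - 1 / 2) * (m * (2 * π / P))) = sin (0 - m * (2 * π / P) / 2) := by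
      rw [show 0 + (P - 1 / 2) * (m * (2 * π / P)) = 0 - m * (2 * π / P) / 2 + m * (2 * π) by
        field_simp; ring]
      exact sin_add_int_mul_two_pi _ _
    rw [e, sub_self] at key
    rcases mul_eq_zero.1 key with h0 | h0
    · exact absurd h0 (by simpa using hs)
    · rw [← h0]
      refine sum_congr rfl fun j _ => ?_
      rw [circleNode]; ring_nf

theorem sum_cos_mul_cos_circleNode {P : ℕ} (hP : 0 < P) (a b : ℤ) :
    ∑ j ∈ range P, cos (a * circleNode P j) * cos (b * circleNode P j) =
      P / 2 * ((if (P : ℤ) ∣ a + b then 1 else 0) + if (P : ℤ) ∣ a - b then 1 else 0) := by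
  have : ∀ j ∈ range P, cos (a * circleNode P j) * cos (b * circleNode P j) =
      1 / 2 * (cos ((a + b : ℤ) * circleNode P j) + cos ((a - b : ℤ) * circleNode P j)) := by
    intro j _
    push_cast
    rw [add_mul, sub_mul, cos_add, cos_sub]; ring
  rw [sum_congr rfl this, ← mul_sum, sum_add_distrib, sum_cos_circleNode hP,
    sum_cos_circleNode hP]
  split_ifs <;> ring

/-- On `2q` nodes `(-1) ^ j` is the cosine of frequency `q`, and the matching sine vanishes, so an
alternating sign is a frequency shift by `q`. -/
theorem neg_one_pow_mul_cos_circleNode {q : ℕ} (hq : 0 < q) (a : ℤ) (j : ℕ) :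
    (-1) ^ j * cos (a * circleNode (2 * q) j) = cos ((a + q : ℤ) * circleNode (2 * q) j) := by
  have hq' : (q : ℝ) ≠ 0 := by positivity
  rw [show ((a + q : ℤ) : ℝ) * circleNode (2 * q) j = a * circleNode (2 * q) j + j * π by
    rw [circleNode]; push_cast; field_simp, cos_add_nat_mul_pi]

/-! ### Dirichlet kernels -/

/-- The weights `1, 2, 2, …` of the cosine expansion of Dirichlet kernels. -/
def cosWeight (k : ℕ) : ℝ := if k = 0 then 1 else 2

theorem abs_cosWeight_le (k : ℕ) : |cosWeight k| ≤ 2 := by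
  rw [cosWeight]; split_ifs <;> norm_num

/-- The univariate Dirichlet kernel. -/
def dirichletKernel (m : ℕ) (s : ℝ) : ℝ := ∑ k ∈ range (m + 1), cosWeight k * cos (k * s)

theorem sum_cosWeight_mul (m : ℕ) (f : ℕ → ℝ) :
    ∑ k ∈ range (m + 1), cosWeight k * f k = 2 * ∑ k ∈ range (m + 1), f k - f 0 := by
  rw [sum_range_succ', sum_range_succ' f, mul_add, mul_sum]
  simp [cosWeight]; ring

theorem sin_mul_dirichletKernel (m : ℕ) (s : ℝ) :
    sin (s / 2) * dirichletKernel m s = sin ((m + 1 / 2) * s) := by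
  have h := two_mul_sin_mul_sum_cos (m + 1) s 0
  rw [dirichletKernel, sum_cosWeight_mul m fun k => cos (k * s)]
  simp only [zero_add, zero_sub, sin_neg] at h
  push_cast at h
  rw [show ((m : ℝ) + 1 - 1 / 2) * s = (m + 1 / 2) * s by ring] at h
  rw [Nat.cast_zero, zero_mul, cos_zero]
  linear_combination h

theorem abs_sum_cosWeight_mul_le (m : ℕ) (f : ℕ → ℝ) {A : ℝ} (hf : ∀ k, |f k| ≤ A) :
    |∑ k ∈ range (m + 1), cosWeight k * f k| ≤ 2 * (m + 1) * A := by
  refine (abs_sum_le_sum_abs _ _).trans ?_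
  refine (sum_le_sum (g := fun _ => 2 * A) fun k _ => ?_).trans_eq ?_
  · rw [abs_mul]
    exact mul_le_mul (abs_cosWeight_le k) (hf k) (abs_nonneg _) (by norm_num)
  · simp; ring

/-- The function `min N (1 / |sin (u / 2)|)`. -/
def peak (N : ℕ) (u : ℝ) : ℝ := N / max 1 (N * |sin (u / 2)|)

theorem peak_nonneg (N : ℕ) (u : ℝ) : 0 ≤ peak N u := by
  rw [peak]; positivity

/-- How every kernel estimate below is obtained: a trivial bound by the number of terms, and a bound
after multiplication by `sin (u / 2)`. Writing the minimum as a quotient by `max 1 _` keeps it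
correct where the sine vanishes. -/
theorem le_mul_peak {N : ℕ} {x A u : ℝ} (h1 : x ≤ A * N) (h2 : x * |sin (u / 2)| ≤ A) :
    x ≤ A * peak N u := by
  rw [peak, mul_div_assoc', le_div_iff₀ (by positivity)]
  rcases max_cases 1 (N * |sin (u / 2)|) with ⟨h, -⟩ | ⟨h, -⟩ <;> rw [h]
  · linarith
  · nlinarith [mul_le_mul_of_nonneg_left h2 (Nat.cast_nonneg (α := ℝ) N)]

theorem peak_neg (N : ℕ) (u : ℝ) : peak N (-u) = peak N u := by
  rw [peak, peak, neg_div, sin_neg, abs_neg]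

theorem peak_periodic (N : ℕ) : Function.Periodic (peak N) (2 * π) := by
  intro u
  rw [peak, peak, add_div, mul_div_cancel_left₀ _ two_ne_zero, sin_add_pi, abs_neg]

theorem abs_dirichletKernel_le {m N : ℕ} (h : m + 1 ≤ N) (s : ℝ) :
    |dirichletKernel m s| ≤ 2 * peak N s := by
  apply le_mul_peak
  · refine (abs_sum_cosWeight_mul_le m _ fun k => abs_cos_le_one _).trans ?_
    have : ((m + 1 : ℕ) : ℝ) ≤ N := by exact_mod_cast h
    push_cast at this
    linarith
  · rw [mul_comm, ← abs_mul, sin_mul_dirichletKernel]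
    linarith [abs_sin_le_one ((m + 1 / 2) * s)]

theorem abs_sum_cosWeight_mul_cos_le (n : ℕ) (u β : ℝ) :
    |∑ a ∈ range (n + 1), cosWeight a * cos (β + a * u)| ≤ 3 * peak (n + 1) u := by
  apply le_mul_peak
  · refine (abs_sum_cosWeight_mul_le n _ fun k => abs_cos_le_one _).trans ?_
    push_cast
    nlinarith [Nat.cast_nonneg (α := ℝ) n]
  · rw [sum_cosWeight_mul n fun a => cos (β + a * u)]
    have h1 := abs_sum_cos_mul_abs_sin_le (n + 1) u β
    have h2 := abs_sub (2 * ∑ a ∈ range (n + 1), cos (β + a * u)) (cos (β + (0 : ℕ) * u))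
    have h3 := abs_cos_le_one (β + (0 : ℕ) * u)
    have h4 := abs_sin_le_one (u / 2)
    rw [abs_mul, abs_two] at h2
    have h5 := mul_le_mul_of_nonneg_right h2 (abs_nonneg (sin (u / 2)))
    have h6 := mul_le_mul h3 h4 (abs_nonneg _) zero_le_one
    linarith

/-- The bivariate Dirichlet kernel of the triangle `a + b ≤ n`. -/
def triangleKernel (n : ℕ) (s t : ℝ) : ℝ :=
  ∑ a ∈ range (n + 1), cosWeight a * (cos (a * s) * dirichletKernel (n - a) t)

theorem sum_triangle_comm (n : ℕ) (f : ℕ → ℕ → ℝ) :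
    ∑ a ∈ range (n + 1), ∑ b ∈ range (n - a + 1), f a b =
      ∑ b ∈ range (n + 1), ∑ a ∈ range (n - b + 1), f a b := by
  refine sum_comm' fun a b => ?_
  simp only [mem_range]; omega

theorem triangleKernel_eq (n : ℕ) (s t : ℝ) : triangleKernel n s t =
    ∑ a ∈ range (n + 1), ∑ b ∈ range (n - a + 1),
      cosWeight a * cos (a * s) * (cosWeight b * cos (b * t)) := by
  simp only [triangleKernel, dirichletKernel, mul_sum, mul_assoc]

theorem triangleKernel_comm (n : ℕ) (s t : ℝ) : triangleKernel n s t = triangleKernel n t s := by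
  rw [triangleKernel_eq, triangleKernel_eq, sum_triangle_comm]
  simp only [mul_comm]

theorem abs_triangleKernel_le_mul (n : ℕ) (s t : ℝ) :
    |triangleKernel n s t| ≤ 4 * peak (n + 1) s * (n + 1 : ℕ) := by
  -- Exchanging the variables makes the inner Dirichlet kernel one in `s`, so that decay in `s`
  -- survives the trivial sum over the other frequency.
  rw [triangleKernel_comm, triangleKernel]
  refine (abs_sum_cosWeight_mul_le n _ (A := 2 * peak (n + 1) s) fun k => ?_).trans ?_
  · rw [abs_mul]
    have := mul_le_mul (abs_cos_le_one (k * t))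
      (abs_dirichletKernel_le (N := n + 1) (m := n - k) (by omega) s) (abs_nonneg _) zero_le_one
    linarith
  · push_cast; linarith

/-- Multiplying by `sin (t / 2)` collapses the inner kernel to `sin ((n - a + 1/2) t)`. Since its
frequency decreases with `a`, the product with `cos (a s)` splits into two arithmetic progressions,
with steps `s - t` and `-(s + t)`. -/
theorem abs_triangleKernel_mul_abs_sin_le (n : ℕ) (s t : ℝ) :
    |triangleKernel n s t| * |sin (t / 2)| ≤
      3 / 2 * (peak (n + 1) (s - t) + peak (n + 1) (s + t)) := by
  have h : triangleKernel n s t * sin (t / 2) =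
      1 / 2 * (∑ a ∈ range (n + 1), cosWeight a * cos (((n + 1 / 2) * t - π / 2) + a * (s - t)) +
        ∑ a ∈ range (n + 1), cosWeight a * cos (((n + 1 / 2) * t - π / 2) + a * -(s + t))) := by
    rw [triangleKernel, sum_mul, ← sum_add_distrib, mul_sum]
    refine sum_congr rfl fun a ha => ?_
    have han : a ≤ n := by simpa [Nat.lt_succ_iff] using ha
    have h1 := sin_mul_dirichletKernel (n - a) t
    rw [Nat.cast_sub han] at h1
    have e1 : cos (((n + 1 / 2) * t - π / 2) + a * (s - t)) =
        sin ((n - a + 1 / 2) * t + a * s) := by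
      rw [← cos_sub_pi_div_two]; ring_nf
    have e2 : cos (((n + 1 / 2) * t - π / 2) + a * -(s + t)) =
        sin ((n - a + 1 / 2) * t - a * s) := by
      rw [← cos_sub_pi_div_two]; ring_nf
    rw [e1, e2, sin_add, sin_sub]
    linear_combination cosWeight a * cos (a * s) * h1
  rw [← abs_mul, h, abs_mul, abs_of_pos (by norm_num : (0 : ℝ) < 1 / 2)]
  have h1 := abs_sum_cosWeight_mul_cos_le n (s - t) ((n + 1 / 2) * t - π / 2)
  have h2 := abs_sum_cosWeight_mul_cos_le n (-(s + t)) ((n + 1 / 2) * t - π / 2)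
  rw [peak_neg] at h2
  linarith [abs_add_le
    (∑ a ∈ range (n + 1), cosWeight a * cos (((n + 1 / 2) * t - π / 2) + a * (s - t)))
    (∑ a ∈ range (n + 1), cosWeight a * cos (((n + 1 / 2) * t - π / 2) + a * -(s + t)))]

theorem abs_triangleKernel_le (n : ℕ) (s t : ℝ) :
    |triangleKernel n s t| ≤
      4 * (peak (n + 1) s + peak (n + 1) (s - t) + peak (n + 1) (s + t)) * peak (n + 1) t := by
  have p1 := peak_nonneg (n + 1) s
  have p2 := peak_nonneg (n + 1) (s - t)
  have p3 := peak_nonneg (n + 1) (s + t)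
  apply le_mul_peak
  · refine (abs_triangleKernel_le_mul n s t).trans ?_
    gcongr
    linarith
  · linarith [abs_triangleKernel_mul_abs_sin_le n s t]

/-! ### Logarithmic bounds for sums over equispaced nodes -/

/-- The logarithmic factor in the bounds for the Lebesgue constants. -/
def logFactor (N : ℕ) : ℝ := 2 + log (2 * N)

/-- A shift by one step only renumbers the nodes, so the base point may be taken in `[0, 2π/P)`. -/
theorem sum_shift_circleNode {f : ℝ → ℝ} (hf : Function.Periodic f (2 * π)) {P : ℕ} (hP : 0 < P) :
    Function.Periodic (fun c => ∑ j ∈ range P, f (c + circleNode P j)) (2 * π / P) := by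
  intro c
  have hP' : (P : ℝ) ≠ 0 := by positivity
  have e : ∀ j : ℕ, c + 2 * π / P + circleNode P j = c + circleNode P (j + 1) := by
    intro j; simp only [circleNode]; push_cast; ring
  simp only [e]
  have h1 := sum_range_succ (fun j => f (c + circleNode P j)) P
  have h2 := sum_range_succ' (fun j => f (c + circleNode P j)) P
  have h3 : c + circleNode P P = c + circleNode P 0 + 2 * π := by
    simp only [circleNode]; field_simp; push_cast; ring
  rw [h3, hf] at h1
  linarith

theorem peak_le_of_mul_le {N : ℕ} {u : ℝ} {i : ℕ} (h : (i : ℝ) ≤ N * |sin (u / 2)|) :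
    peak N u ≤ N / max 1 (i : ℝ) := by
  rw [peak]
  gcongr

theorem sum_div_max_one_le (N : ℕ) {P : ℕ} (hP : 0 < P) (hPN : P ≤ 2 * N) :
    ∑ i ∈ range P, (N : ℝ) / max 1 (i : ℝ) ≤ N * logFactor N := by
  obtain ⟨Q, rfl⟩ := Nat.exists_eq_succ_of_ne_zero hP.ne'
  -- The term `i = 0` contributes `N` and the harmonic sum at most `N (1 + log (2N))`, hence the `2`
  -- in `logFactor`.
  rw [Nat.succ_eq_add_one, sum_range_succ']
  have h1 : ∀ i ∈ range Q, (N : ℝ) / max 1 ((i + 1 : ℕ) : ℝ) = N * (((i + 1 : ℕ) : ℝ)⁻¹) := by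
    intro i _
    rw [max_eq_right (by push_cast; linarith [Nat.cast_nonneg (α := ℝ) i]), div_eq_mul_inv]
  have h2 : ∑ i ∈ range Q, (((i + 1 : ℕ) : ℝ)⁻¹) ≤ 1 + log (2 * N) := by
    have h := harmonic_le_one_add_log Q
    rw [harmonic] at h
    push_cast at h ⊢
    refine h.trans ?_
    have hQ : (Q : ℝ) ≤ 2 * N := by
      have : Q ≤ 2 * N := by omega
      exact_mod_cast this
    have hN : (1 : ℝ) ≤ 2 * N := by
      have : 1 ≤ 2 * N := by omega
      exact_mod_cast this
    rcases Nat.eq_zero_or_pos Q with rfl | hQ0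
    · simpa using log_nonneg hN
    · gcongr
  rw [sum_congr rfl h1, ← mul_sum, logFactor]
  have := mul_le_mul_of_nonneg_left h2 (Nat.cast_nonneg (α := ℝ) N)
  simp only [Nat.cast_zero, zero_le_one, sup_of_le_left, div_one]
  linarith

theorem sum_peak_le {N P : ℕ} (hP : 0 < P) (hPN : P ≤ 2 * N) (c : ℝ) :
    ∑ j ∈ range P, peak N (c + circleNode P j) ≤ 2 * N * logFactor N := by
  have hP' : (0 : ℝ) < P := by positivity
  obtain ⟨d, hd, hcd⟩ := (sum_shift_circleNode (peak_periodic N) hP).exists_mem_Ico₀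
    (by positivity) c
  rw [hcd]
  have hPN' : (P : ℝ) ≤ 2 * N := by exact_mod_cast hPN
  -- After the shift, node `j` is at least `j` steps after `0` and `P - 1 - j` steps before `2π`. By
  -- Jordan's inequality the distance to the nearer end controls `|sin (u / 2)|`, and `P ≤ 2 * N`
  -- turns steps into multiples of `1 / N`. Adding both bounds avoids splitting the sum.
  have step : ∀ j ∈ range P, peak N (d + circleNode P j) ≤
      N / max 1 (j : ℝ) + N / max 1 ((P - 1 - j : ℕ) : ℝ) := by
    intro j hj
    have hj' : j + 1 ≤ P := by simpa using hj
    set u := d + circleNode P j with hu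
    have hlow : j * (2 * π / P) ≤ u := by rw [hu, circleNode]; linarith [hd.1]
    have hup : (P - 1 - j : ℕ) * (2 * π / P) ≤ 2 * π - u := by
      have : ((P - 1 - j : ℕ) : ℝ) = P - 1 - j := by
        rw [Nat.sub_sub, Nat.cast_sub (by omega)]; push_cast; ring
      rw [this, hu, circleNode]
      have e : (P : ℝ) * (2 * π / P) = 2 * π := by field_simp
      linarith [hd.2]
    have scale : ∀ (i : ℕ) (v : ℝ), i * (2 * π / P) ≤ v → (i : ℝ) ≤ N * (v / π) := by
      intro i v hv
      have h1 : (i : ℝ) * (2 / P) ≤ v / π := by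
        rw [le_div_iff₀ pi_pos]; exact le_of_eq_of_le (by ring) hv
      have h2 : (1 : ℝ) ≤ N * (2 / P) := by
        rw [mul_div_assoc', le_div_iff₀ hP']; linarith
      calc (i : ℝ) = i * 1 := by ring
        _ ≤ i * (N * (2 / P)) := by gcongr
        _ = N * (i * (2 / P)) := by ring
        _ ≤ _ := by gcongr
    have hu0 : 0 ≤ u := le_trans (by positivity) hlow
    have hu2 : 0 ≤ 2 * π - u := le_trans (by positivity) hup
    have n1 : (0 : ℝ) ≤ N / max 1 (j : ℝ) := by positivity
    have n2 : (0 : ℝ) ≤ N / max 1 ((P - 1 - j : ℕ) : ℝ) := by positivity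
    rcases le_total u π with h | h
    · have hs : u / π ≤ |sin (u / 2)| := by
        refine le_trans ?_ (le_abs_self _)
        have := mul_le_sin (x := u / 2) (by linarith) (by linarith)
        refine le_trans (le_of_eq ?_) this
        field_simp
      have := peak_le_of_mul_le ((scale j u hlow).trans
        (mul_le_mul_of_nonneg_left hs (Nat.cast_nonneg N)))
      linarith
    · have hs : (2 * π - u) / π ≤ |sin (u / 2)| := by
        refine le_trans ?_ (le_abs_self _)
        have := mul_le_sin (x := (2 * π - u) / 2) (by linarith) (by linarith)
        rw [show (2 * π - u) / 2 = π - u / 2 by ring, sin_pi_sub] at this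
        refine le_trans (le_of_eq ?_) this
        field_simp
      have := peak_le_of_mul_le ((scale _ _ hup).trans
        (mul_le_mul_of_nonneg_left hs (Nat.cast_nonneg N)))
      linarith
  refine (sum_le_sum step).trans ?_
  rw [sum_add_distrib, sum_range_reflect (fun i : ℕ => (N : ℝ) / max 1 (i : ℝ)) P]
  linarith [sum_div_max_one_le N hP hPN]

theorem sum_abs_triangleKernel_le {n P Q : ℕ} (hP : 0 < P) (hPn : P ≤ 2 * (n + 1)) (hQ : 0 < Q)
    (hQn : Q ≤ 2 * (n + 1)) (c d : ℝ) :
    ∑ j ∈ range P, ∑ k ∈ range Q, |triangleKernel n (c + circleNode P j) (d + circleNode Q k)| ≤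
      48 * (n + 1) ^ 2 * logFactor (n + 1) ^ 2 := by
  set B : ℝ := 2 * (n + 1 : ℕ) * logFactor (n + 1) with hB
  have hinner : ∀ t : ℝ, ∑ j ∈ range P, |triangleKernel n (c + circleNode P j) t| ≤
      12 * B * peak (n + 1) t := by
    intro t
    refine (sum_le_sum fun j _ => abs_triangleKernel_le n (c + circleNode P j) t).trans ?_
    rw [← sum_mul, ← mul_sum, sum_add_distrib, sum_add_distrib]
    refine mul_le_mul_of_nonneg_right ?_ (peak_nonneg _ _)
    have h1 := sum_peak_le (N := n + 1) hP hPn c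
    have h2 := sum_peak_le (N := n + 1) hP hPn (c - t)
    have h3 := sum_peak_le (N := n + 1) hP hPn (c + t)
    -- For fixed `t` the peaks at `s ∓ t` are sampled on the same equispaced nodes with another base
    -- point, so each of the three sums is at most `B`.
    simp only [sub_add_eq_add_sub, add_right_comm c t] at h2 h3
    linarith
  have hB0 : 0 ≤ B := (sum_nonneg fun j _ => peak_nonneg _ _).trans
    (sum_peak_le (N := n + 1) hP hPn c)
  rw [sum_comm]
  refine (sum_le_sum fun k _ => hinner (d + circleNode Q k)).trans ?_
  rw [← mul_sum]
  refine (mul_le_mul_of_nonneg_left (sum_peak_le (N := n + 1) hQ hQn d) (by positivity)).trans_eq ?_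
  rw [hB]; push_cast; ring

/-! ### Reproducing kernels on equispaced nodes -/

/-- The cosine weights for `2 * n` equispaced nodes, for which the frequencies `0` and `n` both have
norm one. -/
def gridWeight (n a : ℕ) : ℝ := if a = 0 ∨ a = n then 1 else 2

theorem sum_cos_mul_cos_grid {n a b : ℕ} (hn : 0 < n) (ha : a ≤ n) (hb : b ≤ n) :
    gridWeight n b * ∑ j ∈ range (2 * n),
      cos (a * circleNode (2 * n) j) * cos (b * circleNode (2 * n) j) =
      if a = b then 2 * (n : ℝ) else 0 := by
  have h := sum_cos_mul_cos_circleNode (P := 2 * n) (by omega) a b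
  simp only [Int.cast_natCast] at h
  rw [h, gridWeight]
  -- Only the frequency pairs `0, 0` and `n, n` also alias through the sum `a + b`; their squared
  -- norm doubles, which `gridWeight` compensates.
  have d2 : ((2 * n : ℕ) : ℤ) ∣ (a : ℤ) - b ↔ a = b := by
    constructor
    · intro hd
      have := Int.eq_zero_of_abs_lt_dvd hd (by rw [abs_lt]; constructor <;> push_cast <;> omega)
      omega
    · rintro rfl; simp
  have d1 : ((2 * n : ℕ) : ℤ) ∣ (a : ℤ) + b ↔ a = b ∧ (b = 0 ∨ b = n) := by
    constructor
    · intro hd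
      by_cases h0 : a + b = 0
      · omega
      · have := Int.le_of_dvd (by omega) hd
        push_cast at this
        omega
    · rintro ⟨rfl, rfl | rfl⟩
      · simp
      · exact ⟨1, by push_cast; ring⟩
  simp only [d1, d2]
  by_cases hab : a = b <;> by_cases hb' : b = 0 ∨ b = n <;> simp [hab, hb']
  ring

theorem sum_cos_mul_cos_fine {n a b : ℕ} (ha : a ≤ n) (hb : b ≤ n) :
    cosWeight b * ∑ j ∈ range (2 * (n + 1)),
      cos (a * circleNode (2 * (n + 1)) j) * cos (b * circleNode (2 * (n + 1)) j) =
      if a = b then 2 * ((n : ℝ) + 1) else 0 := by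
  have h := sum_cos_mul_cos_grid (n := n + 1) (a := a) (b := b) (by omega) (by omega) (by omega)
  have hw : gridWeight (n + 1) b = cosWeight b := by
    have : b ≠ n + 1 := by omega
    simp [gridWeight, cosWeight, this]
  rw [hw] at h
  rw [h]; push_cast; rfl

theorem sum_alternating_mul_eq_zero {n a b c d : ℕ} (hn : 0 < n) (hab : a + b ≤ n)
    (hcd : c + d ≤ n) :
    (∑ j ∈ range (2 * n), (-1) ^ j *
      (cos (a * circleNode (2 * n) j) * cos (c * circleNode (2 * n) j))) *
    (∑ k ∈ range (2 * (n + 1)), (-1) ^ k *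
      (cos (b * circleNode (2 * (n + 1)) k) * cos (d * circleNode (2 * (n + 1)) k))) = 0 := by
  have alt : ∀ (q : ℕ) (_ : 0 < q) (x y : ℕ), ∑ j ∈ range (2 * q), (-1) ^ j *
      (cos (x * circleNode (2 * q) j) * cos (y * circleNode (2 * q) j)) =
      q * ((if ((2 * q : ℕ) : ℤ) ∣ (x + q : ℤ) + y then 1 else 0) +
        if ((2 * q : ℕ) : ℤ) ∣ (x + q : ℤ) - y then 1 else 0) := by
    intro q hq x y
    have h := sum_cos_mul_cos_circleNode (P := 2 * q) (by omega) (x + q) y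
    have e : ((2 * q : ℕ) : ℝ) / 2 = q := by push_cast; ring
    rw [e] at h
    rw [← h]
    refine sum_congr rfl fun j _ => ?_
    have := neg_one_pow_mul_cos_circleNode hq x j
    rw [← mul_assoc, ← this]; simp
  have no : ∀ {P m : ℤ}, 0 < m → m < P → ¬ P ∣ m := fun h1 h2 h3 => by
    have := Int.le_of_dvd h1 h3; omega
  rw [alt n hn, alt (n + 1) (by omega)]
  -- The second factor can alias only if `b + d = n + 1`. Then `a + c ≤ n - 1`, so `a + n ± c` lies
  -- strictly between `0` and `2n` and the first factor vanishes.
  by_cases hbd : b + d = n + 1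
  · rw [if_neg (no (by omega) (by push_cast; omega)), if_neg (no (by omega) (by push_cast; omega))]
    simp
  · rw [if_neg (c := _ ∣ ((b : ℤ) + (n + 1 : ℕ)) + d) ?_,
      if_neg (c := _ ∣ ((b : ℤ) + (n + 1 : ℕ)) - d) (no (by omega) (by push_cast; omega))]
    · simp
    · rintro ⟨r, hr⟩
      push_cast at hr
      have h1 : 0 < r := by
        by_contra h
        nlinarith [Int.not_lt.1 h]
      have h2 : r < 2 := by
        by_contra h
        nlinarith [Int.not_lt.1 h]
      obtain rfl : r = 1 := by omega
      omega

/-- The reproducing kernel for trigonometric cosine polynomials of degree `n` on `2 * n` nodes. -/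
def gridKernel (n : ℕ) (σ s : ℝ) : ℝ :=
  ∑ a ∈ range (n + 1), gridWeight n a * (cos (a * σ) * cos (a * s))

/-- The reproducing kernel for the Padua points. -/
def paduaKernel (n : ℕ) (σ τ s t : ℝ) : ℝ :=
  ∑ a ∈ range (n + 1), ∑ b ∈ range (n - a + 1),
    gridWeight n a * (cos (a * σ) * cos (a * s)) * (cosWeight b * (cos (b * τ) * cos (b * t)))

theorem gridKernel_reproduces {n a : ℕ} (hn : 0 < n) (ha : a ≤ n) (s : ℝ) :
    ∑ j ∈ range (2 * n), cos (a * circleNode (2 * n) j) * gridKernel n (circleNode (2 * n) j) s =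
      2 * n * cos (a * s) := by
  simp only [gridKernel, mul_sum]
  rw [sum_comm]
  have h : ∀ b ∈ range (n + 1), ∑ j ∈ range (2 * n), cos (a * circleNode (2 * n) j) *
      (gridWeight n b * (cos (b * circleNode (2 * n) j) * cos (b * s))) =
      if a = b then 2 * n * cos (a * s) else 0 := by
    intro b hb
    have := sum_cos_mul_cos_grid hn ha (by simpa [Nat.lt_succ_iff] using hb : b ≤ n)
    trans (if a = b then 2 * (n : ℝ) else 0) * cos (b * s)
    · rw [← this, mul_sum, sum_mul]
      exact sum_congr rfl fun j _ => by ring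
    · split_ifs with hab
      · rw [hab]
      · simp
  rw [sum_congr rfl h, sum_ite_eq]
  simp [ha]

theorem paduaKernel_reproduces {n a b : ℕ} (hn : 0 < n) (hab : a + b ≤ n) (s t : ℝ) :
    ∑ j ∈ range (2 * n), ∑ k ∈ range (2 * (n + 1)), (1 + (-1) ^ j * (-1) ^ k) *
      (cos (a * circleNode (2 * n) j) * cos (b * circleNode (2 * (n + 1)) k)) *
        paduaKernel n (circleNode (2 * n) j) (circleNode (2 * (n + 1)) k) s t =
      4 * n * (n + 1) * (cos (a * s) * cos (b * t)) := by
  have key : ∀ c ∈ range (n + 1), ∀ d ∈ range (n - c + 1),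
      ∑ j ∈ range (2 * n), ∑ k ∈ range (2 * (n + 1)), (1 + (-1) ^ j * (-1) ^ k) *
        (cos (a * circleNode (2 * n) j) * cos (b * circleNode (2 * (n + 1)) k)) *
        (gridWeight n c * (cos (c * circleNode (2 * n) j) * cos (c * s)) *
          (cosWeight d * (cos (d * circleNode (2 * (n + 1)) k) * cos (d * t)))) =
      if c = a then (if d = b then 4 * n * (n + 1) * (cos (a * s) * cos (b * t)) else 0) else 0 := by
    intro c hc d hd
    simp only [mem_range] at hc hd
    have h1 := sum_cos_mul_cos_grid hn (by omega : a ≤ n) (by omega : c ≤ n)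
    have h2 := sum_cos_mul_cos_fine (by omega : b ≤ n) (by omega : d ≤ n)
    have h3 := sum_alternating_mul_eq_zero hn hab (by omega : c + d ≤ n)
    -- Expanding `1 + (-1) ^ j * (-1) ^ k` leaves two products of univariate sums: the orthogonality
    -- relations and the vanishing alternating part.
    trans (gridWeight n c * ∑ j ∈ range (2 * n),
        cos (a * circleNode (2 * n) j) * cos (c * circleNode (2 * n) j)) *
      (cosWeight d * ∑ k ∈ range (2 * (n + 1)),
        cos (b * circleNode (2 * (n + 1)) k) * cos (d * circleNode (2 * (n + 1)) k)) *
          (cos (c * s) * cos (d * t)) +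
      gridWeight n c * cosWeight d * (cos (c * s) * cos (d * t)) *
      ((∑ j ∈ range (2 * n), (-1) ^ j *
        (cos (a * circleNode (2 * n) j) * cos (c * circleNode (2 * n) j))) *
      (∑ k ∈ range (2 * (n + 1)), (-1) ^ k *
        (cos (b * circleNode (2 * (n + 1)) k) * cos (d * circleNode (2 * (n + 1)) k))))
    · rw [mul_mul_mul_comm (gridWeight n c), sum_mul_sum, sum_mul_sum]
      simp only [mul_sum, sum_mul, ← sum_add_distrib]
      exact sum_congr rfl fun j _ => sum_congr rfl fun k _ => by ring
    · rw [h1, h2, h3]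
      by_cases hca : a = c <;> by_cases hdb : b = d
      · subst hca hdb; simp only [if_true, mul_zero, add_zero]; ring
      all_goals simp [hca, hdb, eq_comm]
  have swap : ∑ j ∈ range (2 * n), ∑ k ∈ range (2 * (n + 1)), (1 + (-1) ^ j * (-1) ^ k) *
      (cos (a * circleNode (2 * n) j) * cos (b * circleNode (2 * (n + 1)) k)) *
        paduaKernel n (circleNode (2 * n) j) (circleNode (2 * (n + 1)) k) s t =
      ∑ c ∈ range (n + 1), ∑ d ∈ range (n - c + 1),
      ∑ j ∈ range (2 * n), ∑ k ∈ range (2 * (n + 1)), (1 + (-1) ^ j * (-1) ^ k) *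
        (cos (a * circleNode (2 * n) j) * cos (b * circleNode (2 * (n + 1)) k)) *
        (gridWeight n c * (cos (c * circleNode (2 * n) j) * cos (c * s)) *
          (cosWeight d * (cos (d * circleNode (2 * (n + 1)) k) * cos (d * t)))) := by
    simp only [paduaKernel, mul_sum]
    rw [sum_congr rfl fun j _ => sum_comm, sum_comm]
    refine sum_congr rfl fun c _ => ?_
    rw [sum_congr rfl fun j _ => sum_comm, sum_comm]
  rw [swap, sum_congr rfl fun c hc => sum_congr rfl (key c hc)]
  rw [sum_eq_single a, sum_eq_single b]
  · simp
  · intro d _ hd; simp [hd]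
  · intro h; exact absurd (mem_range.2 (by omega)) h
  · intro c _ hc; simp [hc]
  · intro h; exact absurd (mem_range.2 (by omega)) h

/-- The sign is placed on `s`, so the node angle always enters with a plus and the sums over `c +
circleNode P j` apply with `c = ±s`. -/
theorem cos_mul_cos_eq (x σ s : ℝ) :
    cos (x * σ) * cos (x * s) = 1 / 2 * (cos (x * (s + σ)) + cos (x * (-s + σ))) := by
  rw [mul_add x, mul_add x, cos_add, cos_add, mul_neg, cos_neg, sin_neg]; ring

theorem sum_gridWeight_sub {n : ℕ} (hn : 0 < n) (f : ℕ → ℝ) :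
    ∑ a ∈ range (n + 1), gridWeight n a * f a =
      ∑ a ∈ range (n + 1), cosWeight a * f a - f n := by
  rw [sum_range_succ, sum_range_succ (fun a => cosWeight a * f a)]
  have h : ∀ a ∈ range n, gridWeight n a * f a = cosWeight a * f a := by
    intro a ha
    have : a ≠ n := (mem_range.1 ha).ne
    simp [gridWeight, cosWeight, this]
  rw [sum_congr rfl h]
  simp [gridWeight, cosWeight, hn.ne']; ring

theorem gridKernel_eq {n : ℕ} (hn : 0 < n) (σ s : ℝ) :
    gridKernel n σ s = 1 / 2 * (dirichletKernel n (s + σ) + dirichletKernel n (-s + σ)) -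
      cos (n * σ) * cos (n * s) := by
  rw [gridKernel, sum_gridWeight_sub hn fun a => cos (a * σ) * cos (a * s), dirichletKernel,
    dirichletKernel, ← sum_add_distrib, mul_sum]
  congr 1
  refine sum_congr rfl fun a _ => ?_
  rw [cos_mul_cos_eq]; ring

/-- The weights differ from those of the triangle kernel only at `a = n`, which forces `b = 0`;
hence a single correction term. -/
theorem paduaKernel_eq {n : ℕ} (hn : 0 < n) (σ τ s t : ℝ) :
    paduaKernel n σ τ s t =
      1 / 4 * (triangleKernel n (s + σ) (t + τ) + triangleKernel n (s + σ) (-t + τ) +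
        triangleKernel n (-s + σ) (t + τ) + triangleKernel n (-s + σ) (-t + τ)) -
      cos (n * σ) * cos (n * s) := by
  have h : paduaKernel n σ τ s t = ∑ a ∈ range (n + 1), gridWeight n a *
      (cos (a * σ) * cos (a * s) * ∑ b ∈ range (n - a + 1),
        (cosWeight b * (cos (b * τ) * cos (b * t)))) := by
    simp only [paduaKernel, mul_sum, mul_assoc]
  rw [h, sum_gridWeight_sub hn fun a => cos (a * σ) * cos (a * s) * ∑ b ∈ range (n - a + 1),
        (cosWeight b * (cos (b * τ) * cos (b * t)))]
  congr 1
  · simp only [triangleKernel_eq, mul_sum, ← sum_add_distrib]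
    refine sum_congr rfl fun a _ => sum_congr rfl fun b _ => ?_
    rw [cos_mul_cos_eq, cos_mul_cos_eq]; ring
  · simp [cosWeight]

/-! ### Lebesgue constants -/

/-- Bound for the Lebesgue constant of the univariate grid. -/
def gridBound (n : ℕ) : ℝ := 8 * logFactor (n + 1) + 1

/-- Bound for the Lebesgue constant of the Padua points. -/
def paduaBound (n : ℕ) : ℝ := 48 * logFactor (n + 1) ^ 2 + 2

theorem logFactor_nonneg (N : ℕ) : 0 ≤ logFactor N := by
  rw [logFactor]
  have := log_natCast_nonneg (2 * N)
  push_cast at this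
  linarith

theorem gridBound_nonneg (n : ℕ) : 0 ≤ gridBound n := by
  rw [gridBound]; linarith [logFactor_nonneg (n + 1)]

theorem paduaBound_nonneg (n : ℕ) : 0 ≤ paduaBound n := by
  rw [paduaBound]; positivity

theorem sum_abs_gridKernel_le {n : ℕ} (hn : 0 < n) (s : ℝ) :
    ∑ j ∈ range (2 * n), |gridKernel n (circleNode (2 * n) j) s| ≤ 2 * n * gridBound n := by
  have h1 : ∀ j ∈ range (2 * n), |gridKernel n (circleNode (2 * n) j) s| ≤
      peak (n + 1) (s + circleNode (2 * n) j) + peak (n + 1) (-s + circleNode (2 * n) j) + 1 := by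
    intro j _
    set u := circleNode (2 * n) j
    rw [gridKernel_eq hn]
    have a1 := abs_le.1 (abs_dirichletKernel_le (le_refl (n + 1)) (s + u))
    have a2 := abs_le.1 (abs_dirichletKernel_le (le_refl (n + 1)) (-s + u))
    have a3 : |cos (n * u) * cos (n * s)| ≤ 1 := by
      rw [abs_mul]
      exact mul_le_one₀ (abs_cos_le_one _) (abs_nonneg _) (abs_cos_le_one _)
    rw [abs_le] at a3 ⊢
    constructor <;> linarith [a1.1, a1.2, a2.1, a2.2, a3.1, a3.2]
  refine (sum_le_sum h1).trans ?_
  rw [sum_add_distrib, sum_add_distrib]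
  have b1 := sum_peak_le (N := n + 1) (P := 2 * n) (by omega) (by omega) s
  have b2 := sum_peak_le (N := n + 1) (P := 2 * n) (by omega) (by omega) (-s)
  simp only [sum_const, card_range, nsmul_eq_mul, mul_one, gridBound]
  push_cast at b1 b2 ⊢
  have hn1 : (1 : ℝ) ≤ n := by exact_mod_cast hn
  have hL := mul_le_mul_of_nonneg_right hn1 (logFactor_nonneg (n + 1))
  linarith [logFactor_nonneg (n + 1)]

theorem sum_abs_paduaKernel_le {n : ℕ} (hn : 0 < n) (s t : ℝ) :
    ∑ j ∈ range (2 * n), ∑ k ∈ range (2 * (n + 1)),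
      |paduaKernel n (circleNode (2 * n) j) (circleNode (2 * (n + 1)) k) s t| ≤
        2 * n * (n + 1) * paduaBound n := by
  have h1 : ∀ j ∈ range (2 * n), ∀ k ∈ range (2 * (n + 1)),
      |paduaKernel n (circleNode (2 * n) j) (circleNode (2 * (n + 1)) k) s t| ≤
      1 / 4 * (|triangleKernel n (s + circleNode (2 * n) j) (t + circleNode (2 * (n + 1)) k)| +
        |triangleKernel n (s + circleNode (2 * n) j) (-t + circleNode (2 * (n + 1)) k)| +
        |triangleKernel n (-s + circleNode (2 * n) j) (t + circleNode (2 * (n + 1)) k)| +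
        |triangleKernel n (-s + circleNode (2 * n) j) (-t + circleNode (2 * (n + 1)) k)|) + 1 := by
    intro j _ k _
    set u := circleNode (2 * n) j
    set v := circleNode (2 * (n + 1)) k
    rw [paduaKernel_eq hn]
    have a1 := abs_le.1 (le_refl |triangleKernel n (s + u) (t + v)|)
    have a2 := abs_le.1 (le_refl |triangleKernel n (s + u) (-t + v)|)
    have a4 := abs_le.1 (le_refl |triangleKernel n (-s + u) (t + v)|)
    have a5 := abs_le.1 (le_refl |triangleKernel n (-s + u) (-t + v)|)
    have a3 : |cos (n * u) * cos (n * s)| ≤ 1 := by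
      rw [abs_mul]
      exact mul_le_one₀ (abs_cos_le_one _) (abs_nonneg _) (abs_cos_le_one _)
    rw [abs_le] at a3
    rw [abs_le (a := 1 / 4 * _ - _)]
    constructor <;> linarith [a1.1, a1.2, a2.1, a2.2, a3.1, a3.2, a4.1, a4.2, a5.1, a5.2]
  refine (sum_le_sum fun j hj => sum_le_sum (h1 j hj)).trans ?_
  simp only [sum_add_distrib, ← mul_sum]
  have b := fun c d => sum_abs_triangleKernel_le (n := n) (P := 2 * n) (Q := 2 * (n + 1))
    (by omega) (by omega) (by omega) (by omega) c d
  have b1 := b s t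
  have b2 := b s (-t)
  have b3 := b (-s) t
  have b4 := b (-s) (-t)
  simp only [sum_const, card_range, nsmul_eq_mul, mul_one, paduaBound]
  push_cast
  have hn1 : (1 : ℝ) ≤ n := by exact_mod_cast hn
  -- The sum is at most `48 (n+1)² L² + 4n(n+1)`; using `n + 1 ≤ 2n` on one factor produces exactly
  -- `paduaBound`.
  have hL : 0 ≤ (n + 1) * logFactor (n + 1) ^ 2 := by positivity
  have hL' := mul_le_mul_of_nonneg_right hn1 hL
  nlinarith

/-- Cosine polynomials of degree at most `n`. -/
def cosSpan (n : ℕ) : Submodule ℝ (ℝ → ℝ) :=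
  Submodule.span ℝ {f | ∃ a ≤ n, f = fun s => cos (a * s)}

/-- Bivariate cosine polynomials of total degree at most `n`. -/
def cosSpan₂ (n : ℕ) : Submodule ℝ (ℝ → ℝ → ℝ) :=
  Submodule.span ℝ {f | ∃ a b, a + b ≤ n ∧ f = fun s t => cos ((a : ℕ) * s) * cos ((b : ℕ) * t)}

theorem sum_mul_gridKernel {n : ℕ} (hn : 0 < n) {f : ℝ → ℝ} (hf : f ∈ cosSpan n) (s : ℝ) :
    ∑ j ∈ range (2 * n), f (circleNode (2 * n) j) * gridKernel n (circleNode (2 * n) j) s =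
      2 * n * f s := by
  induction hf using Submodule.span_induction with
  | mem f hf => obtain ⟨a, ha, rfl⟩ := hf; exact gridKernel_reproduces hn ha s
  | zero => simp
  | add f g _ _ hf hg => simp only [Pi.add_apply, add_mul, sum_add_distrib, hf, hg]; ring
  | smul c f _ hf => simp only [Pi.smul_apply, smul_eq_mul, mul_assoc, ← mul_sum, hf]; ring

theorem sum_mul_paduaKernel {n : ℕ} (hn : 0 < n) {f : ℝ → ℝ → ℝ} (hf : f ∈ cosSpan₂ n)
    (s t : ℝ) :
    ∑ j ∈ range (2 * n), ∑ k ∈ range (2 * (n + 1)), (1 + (-1) ^ j * (-1) ^ k) *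
      f (circleNode (2 * n) j) (circleNode (2 * (n + 1)) k) *
        paduaKernel n (circleNode (2 * n) j) (circleNode (2 * (n + 1)) k) s t =
      4 * n * (n + 1) * f s t := by
  induction hf using Submodule.span_induction with
  | mem f hf => obtain ⟨a, b, hab, rfl⟩ := hf; exact paduaKernel_reproduces hn hab s t
  | zero => simp
  | add f g _ _ hf hg =>
    simp only [Pi.add_apply, mul_add _ (f _ _), add_mul, sum_add_distrib] at hf hg ⊢
    linear_combination hf + hg
  | smul c f _ hf =>
    simp only [Pi.smul_apply, smul_eq_mul, mul_left_comm _ c, mul_assoc c, ← mul_sum, hf]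

theorem abs_le_gridBound_mul {n : ℕ} (hn : 0 < n) {f : ℝ → ℝ} (hf : f ∈ cosSpan n) {M : ℝ}
    (hM : ∀ j, |f (circleNode (2 * n) j)| ≤ M) (s : ℝ) : |f s| ≤ gridBound n * M := by
  have h := sum_mul_gridKernel hn hf s
  have hn' : (0 : ℝ) < 2 * n := by positivity
  have hM0 : 0 ≤ M := (abs_nonneg _).trans (hM 0)
  refine le_of_mul_le_mul_left ?_ hn'
  rw [← abs_of_pos hn', ← abs_mul, ← h, abs_of_pos hn']
  refine (abs_sum_le_sum_abs _ _).trans ?_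
  calc _ ≤ ∑ j ∈ range (2 * n), M * |gridKernel n (circleNode (2 * n) j) s| := by
        refine sum_le_sum fun j _ => ?_
        rw [abs_mul]
        gcongr
        exact hM j
    _ ≤ M * (2 * n * gridBound n) := by
        rw [← mul_sum]; gcongr; exact sum_abs_gridKernel_le hn s
    _ = _ := by ring

theorem abs_le_paduaBound_mul {n : ℕ} (hn : 0 < n) {f : ℝ → ℝ → ℝ} (hf : f ∈ cosSpan₂ n) {M : ℝ}
    (hM : ∀ j k, Even (j + k) → |f (circleNode (2 * n) j) (circleNode (2 * (n + 1)) k)| ≤ M)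
    (s t : ℝ) : |f s t| ≤ paduaBound n * M := by
  have h := sum_mul_paduaKernel hn hf s t
  have hn' : (0 : ℝ) < 4 * n * (n + 1) := by positivity
  have hM0 : 0 ≤ M := (abs_nonneg _).trans (hM 0 0 (by simp))
  refine le_of_mul_le_mul_left ?_ hn'
  rw [← abs_of_pos hn', ← abs_mul, ← h, abs_of_pos hn']
  refine (abs_sum_le_sum_abs _ _).trans ?_
  -- The weight is `2` at nodes with `j + k` even, where `f` is bounded by `M`, and `0` at the
  -- others, where nothing is known about `f`.
  calc _ ≤ ∑ j ∈ range (2 * n), ∑ k ∈ range (2 * (n + 1)), 2 * M *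
          |paduaKernel n (circleNode (2 * n) j) (circleNode (2 * (n + 1)) k) s t| := by
        refine sum_le_sum fun j _ => (abs_sum_le_sum_abs _ _).trans (sum_le_sum fun k _ => ?_)
        rw [abs_mul, abs_mul]
        gcongr ?_ * _
        rw [← pow_add]
        rcases Nat.even_or_odd (j + k) with he | ho
        · rw [he.neg_one_pow]
          norm_num
          exact hM j k he
        · rw [ho.neg_one_pow]
          norm_num
          exact hM0
    _ ≤ 2 * M * (2 * n * (n + 1) * paduaBound n) := by
        simp only [← mul_sum]
        gcongr
        exact sum_abs_paduaKernel_le hn s t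
    _ = _ := by ring

/-! ### Polynomials as cosine polynomials -/

theorem cosSpan_mono {m n : ℕ} (h : m ≤ n) : cosSpan m ≤ cosSpan n :=
  Submodule.span_mono fun _ ⟨a, ha, hf⟩ => ⟨a, ha.trans h, hf⟩

theorem cosSpan₂_mono {m n : ℕ} (h : m ≤ n) : cosSpan₂ m ≤ cosSpan₂ n :=
  Submodule.span_mono fun _ ⟨a, b, hab, hf⟩ => ⟨a, b, hab.trans h, hf⟩

theorem cos_mul_mem_cosSpan {n : ℕ} {f : ℝ → ℝ} (hf : f ∈ cosSpan n) :
    (fun s => cos s * f s) ∈ cosSpan (n + 1) := by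
  induction hf using Submodule.span_induction with
  | mem f hf =>
    obtain ⟨a, ha, rfl⟩ := hf
    rcases a with _ | a
    · refine Submodule.subset_span ⟨1, by omega, ?_⟩
      simp
    · have h1 : (fun s => cos (((a + 2 : ℕ) : ℝ) * s)) ∈ cosSpan (n + 1) :=
        Submodule.subset_span ⟨a + 2, by omega, rfl⟩
      have h2 : (fun s => cos ((a : ℝ) * s)) ∈ cosSpan (n + 1) :=
        Submodule.subset_span ⟨a, by omega, rfl⟩
      convert! Submodule.smul_mem _ (1 / 2 : ℝ) (add_mem h1 h2) using 1
      ext s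
      simp only [Pi.smul_apply, Pi.add_apply, smul_eq_mul]
      rw [show ((a + 2 : ℕ) : ℝ) * s = (a + 1 : ℕ) * s + s by push_cast; ring,
        show (a : ℝ) * s = (a + 1 : ℕ) * s - s by push_cast; ring, cos_add, cos_sub]
      ring
  | zero => convert! zero_mem (cosSpan (n + 1)) using 1; ext; simp
  | add f g _ _ hf hg =>
    convert! add_mem hf hg using 1
    ext s; simp [mul_add]
  | smul c f _ hf =>
    convert! Submodule.smul_mem _ c hf using 1
    ext s; simp; ring

theorem cos_pow_mem_cosSpan (n : ℕ) : (fun s => cos s ^ n) ∈ cosSpan n := by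
  induction n with
  | zero => exact Submodule.subset_span ⟨0, le_rfl, by simp⟩
  | succ n ih => simpa only [pow_succ'] using cos_mul_mem_cosSpan ih

theorem mul_mem_cosSpan₂ {m n : ℕ} {f g : ℝ → ℝ} (hf : f ∈ cosSpan m) (hg : g ∈ cosSpan n) :
    (fun s t => f s * g t) ∈ cosSpan₂ (m + n) := by
  induction hf using Submodule.span_induction with
  | mem f hf =>
    obtain ⟨a, ha, rfl⟩ := hf
    induction hg using Submodule.span_induction with
    | mem g hg =>
      obtain ⟨b, hb, rfl⟩ := hg
      exact Submodule.subset_span ⟨a, b, by omega, rfl⟩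
    | zero => convert! zero_mem (cosSpan₂ (m + n)) using 1; ext; simp
    | add g g' _ _ hg hg' => convert! add_mem hg hg' using 1; ext; simp [mul_add]
    | smul c g _ hg => convert! Submodule.smul_mem _ c hg using 1; ext; simp; ring
  | zero => convert! zero_mem (cosSpan₂ (m + n)) using 1; ext; simp
  | add g g' _ _ hg hg' => convert! add_mem hg hg' using 1; ext; simp [add_mul]
  | smul c g _ hg => convert! Submodule.smul_mem _ c hg using 1; ext; simp; ring

/-- The point of the square with angular coordinates `s` and `t`. -/
def squarePoint (s t : ℝ) : Square :=
  ⟨![cos s, cos t], by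
    constructor <;> intro d <;> fin_cases d <;> simp [neg_one_le_cos, cos_le_one]⟩

theorem exists_eq_squarePoint (ω : Square) : ∃ s t, ω = squarePoint s t := by
  refine ⟨arccos (ω.1 0), arccos (ω.1 1), Subtype.ext (funext fun d => ?_)⟩
  fin_cases d
  · simp [squarePoint, cos_arccos (ω.2.1 0) (ω.2.2 0)]
  · simp [squarePoint, cos_arccos (ω.2.1 1) (ω.2.2 1)]

theorem polyFun_squarePoint (p : MvPolynomial (Fin 2) ℝ) (s t : ℝ) :
    polyFun p (squarePoint s t) =
      ∑ d ∈ p.support, p.coeff d * (cos s ^ d 0 * cos t ^ d 1) := by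
  change MvPolynomial.eval _ p = _
  rw [MvPolynomial.eval_eq']
  simp [squarePoint]

theorem polyFun_mem_cosSpan₂ {n : ℕ} {p : MvPolynomial (Fin 2) ℝ}
    (hp : p ∈ totalDegreeSpace n) : (fun s t => polyFun p (squarePoint s t)) ∈ cosSpan₂ n := by
  have h : (fun s t => polyFun p (squarePoint s t)) =
      ∑ d ∈ p.support, p.coeff d • fun s t => cos s ^ d 0 * cos t ^ d 1 := by
    ext s t; simp [polyFun_squarePoint]
  rw [h]
  refine sum_mem fun d hd => Submodule.smul_mem _ _ ?_
  refine cosSpan₂_mono ?_ (mul_mem_cosSpan₂ (cos_pow_mem_cosSpan (d 0)) (cos_pow_mem_cosSpan (d 1)))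
  have := (MvPolynomial.le_totalDegree hd).trans ((MvPolynomial.mem_restrictTotalDegree _ _ _).1 hp)
  rwa [Finsupp.sum_fintype _ _ (fun _ => rfl), Fin.sum_univ_two] at this

theorem polyFun_mem_cosSpan_left {n : ℕ} {p : MvPolynomial (Fin 2) ℝ}
    (hp : p ∈ maximalDegreeSpace n) (t : ℝ) :
    (fun s => polyFun p (squarePoint s t)) ∈ cosSpan n := by
  have h : (fun s => polyFun p (squarePoint s t)) =
      ∑ d ∈ p.support, (p.coeff d * cos t ^ d 1) • fun s => cos s ^ d 0 := by
    ext s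
    simp only [polyFun_squarePoint, Finset.sum_apply, Pi.smul_apply, smul_eq_mul]
    exact sum_congr rfl fun d _ => by ring
  rw [h]
  exact sum_mem fun d hd => Submodule.smul_mem _ _ (cosSpan_mono
    ((MvPolynomial.mem_restrictDegree _ _ _).1 hp d hd 0) (cos_pow_mem_cosSpan (d 0)))

theorem polyFun_mem_cosSpan_right {n : ℕ} {p : MvPolynomial (Fin 2) ℝ}
    (hp : p ∈ maximalDegreeSpace n) (s : ℝ) :
    (fun t => polyFun p (squarePoint s t)) ∈ cosSpan n := by
  have h : (fun t => polyFun p (squarePoint s t)) =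
      ∑ d ∈ p.support, (p.coeff d * cos s ^ d 0) • fun t => cos t ^ d 1 := by
    ext t
    simp only [polyFun_squarePoint, Finset.sum_apply, Pi.smul_apply, smul_eq_mul]
    exact sum_congr rfl fun d _ => by ring
  rw [h]
  exact sum_mem fun d hd => Submodule.smul_mem _ _ (cosSpan_mono
    ((MvPolynomial.mem_restrictDegree _ _ _).1 hp d hd 1) (cos_pow_mem_cosSpan (d 1)))

/-! ### The node sets -/

theorem eval_aeval_X (ω : Fin 2 → ℝ) (i : Fin 2) (q : Polynomial ℝ) :
    MvPolynomial.eval ω (Polynomial.aeval (MvPolynomial.X i) q) = q.eval (ω i) := by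
  induction q using Polynomial.induction_on' with
  | add p q hp hq => simp [hp, hq]
  | monomial n a => simp [Polynomial.aeval_monomial]

theorem onCurve_squarePoint (n : ℕ) (s t : ℝ) :
    OnCurve n (squarePoint s t) ↔ cos (n * s) = cos ((n + 1) * t) := by
  rw [OnCurve, generatingPoly, map_sub, eval_aeval_X, eval_aeval_X, sub_eq_zero]
  simp only [squarePoint, Matrix.cons_val_zero, Matrix.cons_val_one,
    Polynomial.Chebyshev.T_real_cos]
  push_cast; rfl

theorem eval_pderiv_generatingPoly (n : ℕ) (ω : Fin 2 → ℝ) (d : Fin 2) :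
    MvPolynomial.eval ω (MvPolynomial.pderiv d (generatingPoly n)) =
      ![n * (Polynomial.Chebyshev.U ℝ (n - 1)).eval (ω 0),
        -((n + 1) * (Polynomial.Chebyshev.U ℝ n).eval (ω 1))] d := by
  rw [generatingPoly, map_sub, Derivation.map_aeval, Derivation.map_aeval, map_sub, smul_eq_mul,
    smul_eq_mul, map_mul, map_mul, eval_aeval_X, eval_aeval_X,
    Polynomial.Chebyshev.T_derivative_eq_U, Polynomial.Chebyshev.T_derivative_eq_U]
  fin_cases d <;> simp [MvPolynomial.pderiv_X]

theorem sin_eq_zero_iff_cos_sq {x : ℝ} : sin x = 0 ↔ cos x ^ 2 = 1 := by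
  rw [← sin_sq_add_cos_sq x, right_eq_add, sq_eq_zero_iff]

theorem abs_cos_eq_one_iff_sin {x : ℝ} : |cos x| = 1 ↔ sin x = 0 := by
  rw [sin_eq_zero_iff_cos_sq, ← sq_abs, pow_eq_one_iff_of_nonneg (abs_nonneg _) two_ne_zero]

theorem sin_nat_mul_eq_zero (n : ℕ) {x : ℝ} (hx : sin x = 0) : sin (n * x) = 0 := by
  obtain ⟨k, rfl⟩ := sin_eq_zero_iff.1 hx
  exact sin_eq_zero_iff.2 ⟨n * k, by push_cast; ring⟩

/-- The partial derivatives are multiples of `U_{n-1}(cos s)` and `U_n(cos t)`, and `U_{m-1}(cos x)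
sin x = sin (m x)`. At a boundary contact one of the two sines vanishes, and equality of the cosines
on the curve forces the other to vanish. -/
theorem squarePoint_mem_paduaPoints {n : ℕ} (hn : 0 < n) (s t : ℝ) :
    squarePoint s t ∈ paduaPoints n ↔
      sin (n * s) = 0 ∧ sin ((n + 1) * t) = 0 ∧ cos (n * s) = cos ((n + 1) * t) := by
  have U1 := Polynomial.Chebyshev.U_real_cos s (n - 1)
  have U2 := Polynomial.Chebyshev.U_real_cos t n
  push_cast at U1 U2
  rw [sub_add_cancel] at U1
  have hn' : (n : ℝ) ≠ 0 := by positivity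
  have hn1 : (n : ℝ) + 1 ≠ 0 := by positivity
  simp only [paduaPoints, Set.mem_ofPred_eq, IsSelfIntersection, IsBoundaryContact,
    onCurve_squarePoint, eval_pderiv_generatingPoly, Fin.forall_fin_two, Fin.exists_fin_two]
  simp only [squarePoint, Matrix.cons_val_zero, Matrix.cons_val_one, abs_cos_eq_one_iff_sin,
    mul_eq_zero, neg_eq_zero, hn', hn1, false_or]
  constructor
  · rintro (⟨hc, h1, h2⟩ | ⟨hc, h | h⟩)
    · rw [← U1, ← U2, h1, h2]; simp [hc]
    · have h1 := sin_nat_mul_eq_zero n h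
      refine ⟨h1, ?_, hc⟩
      rw [sin_eq_zero_iff_cos_sq] at h1 ⊢
      rwa [← hc]
    · have h1 := sin_nat_mul_eq_zero (n + 1) h
      push_cast at h1
      refine ⟨?_, h1, hc⟩
      rw [sin_eq_zero_iff_cos_sq] at h1 ⊢
      rwa [hc]
  · rintro ⟨h1, h2, hc⟩
    by_cases hs : sin s = 0
    · exact Or.inr ⟨hc, Or.inl hs⟩
    by_cases ht : sin t = 0
    · exact Or.inr ⟨hc, Or.inr ht⟩
    rw [h1] at U1
    rw [h2] at U2
    exact Or.inl ⟨hc, (mul_eq_zero.1 U1).resolve_right hs, (mul_eq_zero.1 U2).resolve_right ht⟩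

theorem mul_circleNode {n : ℕ} (hn : 0 < n) (j : ℕ) : n * circleNode (2 * n) j = j * π := by
  have hn' : (n : ℝ) ≠ 0 := by positivity
  rw [circleNode]; push_cast; field_simp

theorem node_eq {n : ℕ} (hn : 0 < n) (j : ℕ) :
    Polynomial.Chebyshev.node n j = cos (circleNode (2 * n) j) := by
  have hn' : (n : ℝ) ≠ 0 := by positivity
  rw [Polynomial.Chebyshev.node, circleNode]; push_cast; congr 1; field_simp

theorem exists_cos_eq_cos_circleNode {n : ℕ} (hn : 0 < n) {s : ℝ} (hs : sin (n * s) = 0) :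
    ∃ j ≤ n, cos s = cos (circleNode (2 * n) j) ∧ cos (n * s) = (-1) ^ j := by
  have hn' : (0 : ℝ) < n := by positivity
  -- The representative in `[0, π]` gives `0 ≤ j ≤ n`; `cos (n s)` is unchanged because it is `T_n
  -- (cos s)`.
  set r := arccos (cos s) with hr
  have hrs : cos r = cos s := cos_arccos (neg_one_le_cos s) (cos_le_one s)
  have hT : cos (n * r) = cos (n * s) := by
    have h1 := Polynomial.Chebyshev.T_real_cos r n
    have h2 := Polynomial.Chebyshev.T_real_cos s n
    rw [hrs, h2] at h1
    simpa using h1.symm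
  have hr0 : sin (n * r) = 0 := by
    rw [sin_eq_zero_iff_cos_sq] at hs ⊢
    rwa [hT]
  obtain ⟨z, hz⟩ := sin_eq_zero_iff.1 hr0
  have hz0 : 0 ≤ z := by
    have : (0 : ℝ) ≤ z * π := by rw [hz]; exact mul_nonneg hn'.le (arccos_nonneg _)
    exact_mod_cast nonneg_of_mul_nonneg_left this pi_pos
  lift z to ℕ using hz0 with j
  have hjn : j ≤ n := by
    have : (j : ℝ) * π ≤ n * π := by
      rw [Int.cast_natCast] at hz
      rw [hz]; exact mul_le_mul_of_nonneg_left (arccos_le_pi _) hn'.le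
    exact_mod_cast le_of_mul_le_mul_right this pi_pos
  rw [Int.cast_natCast] at hz
  have e : r = circleNode (2 * n) j := mul_left_cancel₀ hn'.ne' (by rw [← hz, mul_circleNode hn])
  refine ⟨j, hjn, by rw [← hrs, e], ?_⟩
  rw [← hT, ← hz, cos_nat_mul_pi]

theorem circleNode_mem_paduaPoints {n : ℕ} (hn : 0 < n) {j k : ℕ} (h : Even (j + k)) :
    squarePoint (circleNode (2 * n) j) (circleNode (2 * (n + 1)) k) ∈ paduaPoints n := by
  have h2 := mul_circleNode (Nat.succ_pos n) k
  push_cast at h2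
  rw [squarePoint_mem_paduaPoints hn, mul_circleNode hn, h2]
  refine ⟨sin_nat_mul_pi j, sin_nat_mul_pi k, ?_⟩
  rw [cos_nat_mul_pi, cos_nat_mul_pi]
  exact neg_one_pow_congr (Nat.even_add.1 h)

theorem circleNode_mem_chebyshevGrid {n : ℕ} (hn : 0 < n) (j k : ℕ) :
    squarePoint (circleNode (2 * n) j) (circleNode (2 * n) k) ∈ chebyshevGrid n := by
  have h : ∀ i, ∃ i' ≤ n, cos (circleNode (2 * n) i) = Polynomial.Chebyshev.node n i' := by
    intro i
    obtain ⟨i', hi', h, -⟩ := exists_cos_eq_cos_circleNode hn (s := circleNode (2 * n) i)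
      (by rw [mul_circleNode hn, sin_nat_mul_pi])
    exact ⟨i', hi', by rw [node_eq hn, h]⟩
  intro d
  fin_cases d
  · simpa [squarePoint] using h j
  · simpa [squarePoint] using h k

theorem paduaPoints_subset {n : ℕ} (hn : 0 < n) : paduaPoints n ⊆
    (fun x : ℕ × ℕ => squarePoint (circleNode (2 * n) x.1) (circleNode (2 * (n + 1)) x.2)) ''
      (((range (n + 1) ×ˢ range (n + 2)).filter fun x => Even (x.1 + x.2) : Finset (ℕ × ℕ)) :
        Set (ℕ × ℕ)) := by
  intro ω hω
  obtain ⟨s, t, rfl⟩ := exists_eq_squarePoint ω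
  obtain ⟨h1, h2, hc⟩ := (squarePoint_mem_paduaPoints hn s t).1 hω
  obtain ⟨j, hj, hsj, hcj⟩ := exists_cos_eq_cos_circleNode hn h1
  obtain ⟨k, hk, htk, hck⟩ := exists_cos_eq_cos_circleNode (n := n + 1) (s := t) (by omega)
    (by push_cast; exact h2)
  push_cast at hck
  rw [hcj, hck] at hc
  refine ⟨(j, k), ?_, ?_⟩
  · simp only [coe_filter, mem_product, mem_range, Set.mem_ofPred_eq]
    refine ⟨⟨by omega, by omega⟩, ?_⟩
    rw [Nat.even_add]
    rcases Nat.even_or_odd j with hj | hj <;> rcases Nat.even_or_odd k with hk | hk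
    · simp [hj, hk]
    · rw [hj.neg_one_pow, hk.neg_one_pow] at hc; norm_num at hc
    · rw [hj.neg_one_pow, hk.neg_one_pow] at hc; norm_num at hc
    · simp [Nat.not_even_iff_odd.2 hj, Nat.not_even_iff_odd.2 hk]
  · simp only [squarePoint, hsj, htk]

theorem chebyshevGrid_subset {n : ℕ} (hn : 0 < n) : chebyshevGrid n ⊆
    (fun x : ℕ × ℕ => squarePoint (circleNode (2 * n) x.1) (circleNode (2 * n) x.2)) ''
      ((range (n + 1) ×ˢ range (n + 1) : Finset (ℕ × ℕ)) : Set (ℕ × ℕ)) := by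
  intro ω hω
  obtain ⟨j, hj, h0⟩ := hω 0
  obtain ⟨k, hk, h1⟩ := hω 1
  refine ⟨(j, k), by simp; omega, Subtype.ext (funext fun d => ?_)⟩
  fin_cases d
  · simp [squarePoint, h0, node_eq hn]
  · simp [squarePoint, h1, node_eq hn]

/-! ### Dimensions -/

/-- The exponent vector of `x ^ a * y ^ b`. -/
def exponent (x : ℕ × ℕ) : Fin 2 →₀ ℕ := Finsupp.equivFunOnFinite.symm ![x.1, x.2]

theorem exponent_injective : Function.Injective exponent := by
  rintro ⟨a, b⟩ ⟨c, d⟩ h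
  have h' := Finsupp.equivFunOnFinite.symm.injective h
  have h0 := congrFun h' 0
  have h1 := congrFun h' 1
  simp at h0 h1
  rw [h0, h1]

theorem exponent_eta (d : Fin 2 →₀ ℕ) : exponent (d 0, d 1) = d := by
  ext i; fin_cases i <;> simp [exponent]

theorem finrank_restrictSupport {S : Set (Fin 2 →₀ ℕ)} {A : Finset (ℕ × ℕ)}
    (h : S = exponent '' (A : Set (ℕ × ℕ))) :
    Module.Finite ℝ (MvPolynomial.restrictSupport ℝ S) ∧
      Module.finrank ℝ (MvPolynomial.restrictSupport ℝ S) = #A := by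
  have hS : S.Finite := by rw [h]; exact A.finite_toSet.image _
  have := hS.to_subtype
  refine ⟨Module.Finite.of_basis (MvPolynomial.basisRestrictSupport ℝ S), ?_⟩
  rw [Module.finrank_eq_nat_card_basis (MvPolynomial.basisRestrictSupport ℝ S)]
  change S.ncard = _
  rw [h, Set.ncard_image_of_injective _ exponent_injective, Set.ncard_coe_finset]

theorem finrank_totalDegreeSpace (n : ℕ) : Module.Finite ℝ (totalDegreeSpace n) ∧
    Module.finrank ℝ (totalDegreeSpace n) =
      #((range (n + 1) ×ˢ range (n + 2)).filter fun x => x.1 + x.2 ≤ n) := by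
  refine finrank_restrictSupport (Set.ext fun d => ?_)
  have hsum : (d.sum fun _ e => e) = d 0 + d 1 := by
    rw [Finsupp.sum_fintype _ _ (fun _ => rfl), Fin.sum_univ_two]
  simp only [Set.mem_ofPred_eq, hsum, Set.mem_image, coe_filter, mem_product, mem_range]
  constructor
  · intro h
    exact ⟨(d 0, d 1), ⟨⟨by simp; omega, by simp; omega⟩, h⟩, exponent_eta d⟩
  · rintro ⟨x, ⟨-, h⟩, rfl⟩
    simpa [exponent] using h

theorem finrank_maximalDegreeSpace (n : ℕ) : Module.Finite ℝ (maximalDegreeSpace n) ∧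
    Module.finrank ℝ (maximalDegreeSpace n) = #(range (n + 1) ×ˢ range (n + 1)) := by
  refine finrank_restrictSupport (Set.ext fun d => ?_)
  simp only [Set.mem_ofPred_eq, Fin.forall_fin_two, Set.mem_image, mem_coe, mem_product, mem_range]
  constructor
  · rintro ⟨h0, h1⟩
    exact ⟨(d 0, d 1), ⟨by simp; omega, by simp; omega⟩, exponent_eta d⟩
  · rintro ⟨x, ⟨h0, h1⟩, rfl⟩
    simp [exponent]; omega

/-- A predicate on an `(n + 1) × (n + 2)` box that is negated by the central reflection holds for
exactly half of its points. -/
theorem two_mul_card_filter_box (n : ℕ) (q : ℕ × ℕ → Prop) [DecidablePred q]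
    (hq : ∀ a ≤ n, ∀ b ≤ n + 1, (q (n - a, n + 1 - b) ↔ ¬ q (a, b))) :
    2 * #((range (n + 1) ×ˢ range (n + 2)).filter q) = (n + 1) * (n + 2) := by
  have h := card_filter_add_card_filter_not (s := range (n + 1) ×ˢ range (n + 2)) q
  have e : #((range (n + 1) ×ˢ range (n + 2)).filter q) =
      #((range (n + 1) ×ˢ range (n + 2)).filter fun x => ¬ q x) := by
    refine card_nbij' (fun x => (n - x.1, n + 1 - x.2)) (fun x => (n - x.1, n + 1 - x.2)) ?_ ?_ ?_ ?_
    · rintro ⟨a, b⟩ hx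
      simp only [coe_filter, mem_product, mem_range, Set.mem_ofPred_eq] at hx ⊢
      refine ⟨by omega, ?_⟩
      rw [hq a (by omega) b (by omega)]
      exact not_not.2 hx.2
    · rintro ⟨a, b⟩ hx
      simp only [coe_filter, mem_product, mem_range, Set.mem_ofPred_eq] at hx ⊢
      refine ⟨by omega, ?_⟩
      rw [hq a (by omega) b (by omega)]
      exact hx.2
    all_goals
      rintro ⟨a, b⟩ hx
      simp only [coe_filter, mem_product, mem_range, Set.mem_ofPred_eq] at hx
      simp only [Prod.mk.injEq]
      omega
  rw [card_product, card_range, card_range] at h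
  omega

theorem card_even_eq_card_triangle (n : ℕ) :
    #((range (n + 1) ×ˢ range (n + 2)).filter fun x => Even (x.1 + x.2)) =
      #((range (n + 1) ×ˢ range (n + 2)).filter fun x => x.1 + x.2 ≤ n) := by
  -- The reflection sends `a + b` to `2n + 1 - (a + b)`, which flips parity and also exchanges `a +
  -- b ≤ n` with its negation. So both sets are half of the box.
  have h1 := two_mul_card_filter_box n (fun x => Even (x.1 + x.2)) (by
    intro a ha b hb
    simp only [Nat.even_iff]
    omega)
  have h2 := two_mul_card_filter_box n (fun x => x.1 + x.2 ≤ n) (by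
    intro a ha b hb
    simp only
    omega)
  omega

/-! ### Near-best interpolation from a Lebesgue constant -/

/-- `polyFun` as a linear map. -/
def polyFunₗ : MvPolynomial (Fin 2) ℝ →ₗ[ℝ] C(Square, ℝ) where
  toFun := polyFun
  map_add' p q := by ext ω; simp [polyFun]
  map_smul' c p := by ext ω; simp [polyFun]

theorem polyFun_injective : Function.Injective polyFun := by
  intro p q h
  refine MvPolynomial.funext_set (fun _ => Set.Icc (-1) 1)
    (fun _ => Set.Icc_infinite (by norm_num)) fun x hx => ?_
  exact congrArg (fun f => f ⟨x, ⟨fun i => (hx i trivial).1, fun i => (hx i trivial).2⟩⟩) h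

theorem exists_isBestApprox (V : Submodule ℝ (MvPolynomial (Fin 2) ℝ)) [Module.Finite ℝ V]
    (α : C(Square, ℝ)) : ∃ q, IsBestApprox V α q := by
  have : ProperSpace (V.map polyFunₗ) := FiniteDimensional.proper ℝ _
  have hlim : Tendsto (fun w : V.map polyFunₗ => ‖α - w‖) (cocompact _) atTop := by
    refine tendsto_atTop_mono (fun w => ?_)
      (tendsto_atTop_add_const_right _ (-‖α‖) (tendsto_norm_cocompact_atTop (E := V.map polyFunₗ)))
    have := norm_sub_norm_le (w : C(Square, ℝ)) α
    rw [norm_sub_rev] at this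
    simpa [sub_eq_add_neg] using this
  obtain ⟨⟨w, q, hq, rfl⟩, hw⟩ := Continuous.exists_forall_le (by fun_prop) hlim
  exact ⟨q, hq, fun r hr => hw ⟨polyFunₗ r, r, hr, rfl⟩⟩

/-- Injectivity supplies the reverse inequality of dimensions, so an upper bound on the number of
nodes suffices and their distinctness need not be checked. -/
theorem existsUnique_isInterpolant {V : Submodule ℝ (MvPolynomial (Fin 2) ℝ)} [Module.Finite ℝ V]
    {X : Set Square} (hX : X.Finite) (hcard : X.ncard ≤ Module.finrank ℝ V)
    (hinj : ∀ p ∈ V, (∀ ω ∈ X, polyFun p ω = 0) → p = 0) (α : C(Square, ℝ)) :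
    ∃! p, IsInterpolant V X α p := by
  have := hX.fintype
  let E : V →ₗ[ℝ] (X → ℝ) :=
    { toFun := fun p ω => polyFunₗ p ω
      map_add' := fun p q => by ext; simp
      map_smul' := fun c p => by ext; simp }
  have hE : Function.Injective E := by
    rw [injective_iff_map_eq_zero]
    intro p hp
    exact Subtype.ext (hinj p p.2 fun ω hω => congrFun hp ⟨ω, hω⟩)
  have hfr : Module.finrank ℝ V = Module.finrank ℝ (X → ℝ) := by
    refine le_antisymm (LinearMap.finrank_le_finrank_of_injective hE) ?_
    rw [Module.finrank_fintype_fun_eq_card, ← Nat.card_eq_fintype_card]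
    exact hcard
  obtain ⟨p, hp⟩ := (LinearMap.injective_iff_surjective_of_finrank_eq_finrank hfr).1 hE
    fun ω => α ω
  refine ⟨p, ⟨p.2, fun ω hω => congrFun hp ⟨ω, hω⟩⟩, fun q hq => ?_⟩
  have : E ⟨q, hq.1⟩ = E p := by
    rw [hp]; ext ω; exact hq.2 ω ω.2
  exact congrArg Subtype.val (hE this)

theorem nearBest_of_lebesgue {V : Submodule ℝ (MvPolynomial (Fin 2) ℝ)} [Module.Finite ℝ V]
    {X : Set Square} (hX : X.Finite) (hcard : X.ncard ≤ Module.finrank ℝ V) {Λ : ℝ}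
    (hΛ : ∀ p ∈ V, ∀ M, (∀ ω ∈ X, |polyFun p ω| ≤ M) → ‖polyFun p‖ ≤ Λ * M) (α : C(Square, ℝ)) :
    (∃! p, IsInterpolant V X α p) ∧ (∃ q, IsBestApprox V α q) ∧
      ∀ p q, IsInterpolant V X α p → IsBestApprox V α q →
        ‖α - polyFun p‖ ≤ (1 + Λ) * ‖α - polyFun q‖ := by
  refine ⟨existsUnique_isInterpolant hX hcard ?_ α, exists_isBestApprox V α, ?_⟩
  · intro p hp h0
    have := hΛ p hp 0 fun ω hω => by simp [h0 ω hω]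
    rw [mul_zero, norm_le_zero_iff] at this
    exact polyFun_injective (this.trans (map_zero polyFunₗ).symm)
  · intro p q hp hq
    have hsub : polyFun (q - p) = polyFun q - polyFun p := map_sub polyFunₗ q p
    -- At the nodes `p` equals `α`, so there `|q - p| = |q - α|`.
    have h := hΛ (q - p) (V.sub_mem hq.1 hp.1) ‖α - polyFun q‖ fun ω hω => by
      rw [hsub, ContinuousMap.sub_apply, hp.2 ω hω, abs_sub_comm]
      exact (α - polyFun q).norm_coe_le_norm ω
    rw [hsub] at h
    have := norm_add_le (α - polyFun q) (polyFun q - polyFun p)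
    rw [sub_add_sub_cancel] at this
    linarith

theorem norm_polyFun_le_paduaBound {n : ℕ} (hn : 0 < n) {p : MvPolynomial (Fin 2) ℝ}
    (hp : p ∈ totalDegreeSpace n) {M : ℝ} (hM : ∀ ω ∈ paduaPoints n, |polyFun p ω| ≤ M) :
    ‖polyFun p‖ ≤ paduaBound n * M := by
  have hM' := fun j k (h : Even (j + k)) => hM _ (circleNode_mem_paduaPoints hn h)
  have hM0 : 0 ≤ M := (abs_nonneg _).trans (hM' 0 0 (by simp))
  rw [ContinuousMap.norm_le _ (mul_nonneg (paduaBound_nonneg n) hM0)]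
  intro ω
  obtain ⟨s, t, rfl⟩ := exists_eq_squarePoint ω
  exact abs_le_paduaBound_mul hn (polyFun_mem_cosSpan₂ hp) hM' s t

theorem norm_polyFun_le_gridBound {n : ℕ} (hn : 0 < n) {p : MvPolynomial (Fin 2) ℝ}
    (hp : p ∈ maximalDegreeSpace n) {M : ℝ} (hM : ∀ ω ∈ chebyshevGrid n, |polyFun p ω| ≤ M) :
    ‖polyFun p‖ ≤ gridBound n ^ 2 * M := by
  have hM' := fun j k => hM _ (circleNode_mem_chebyshevGrid hn j k)
  have hM0 : 0 ≤ M := (abs_nonneg _).trans (hM' 0 0)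
  rw [ContinuousMap.norm_le _ (by positivity)]
  intro ω
  obtain ⟨s, t, rfl⟩ := exists_eq_squarePoint ω
  rw [sq, mul_assoc]
  exact abs_le_gridBound_mul hn (polyFun_mem_cosSpan_left hp t)
    (fun j => abs_le_gridBound_mul hn (polyFun_mem_cosSpan_right hp _) (hM' j) t) s

/-! ### Growth of the bounds -/

theorem one_le_log_and_logFactor_le {n : ℕ} (hn : 3 ≤ n) :
    1 ≤ log n ∧ logFactor (n + 1) ≤ 4 * log n := by
  have hn' : (3 : ℝ) ≤ n := by exact_mod_cast hn
  have h1 : 1 ≤ log n := by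
    rw [le_log_iff_exp_le (by linarith)]
    linarith [exp_one_lt_d9]
  have h2 : log (2 * ((n + 1 : ℕ) : ℝ)) ≤ 2 * log n := by
    rw [show 2 * log n = log ((n : ℝ) ^ 2) by rw [log_pow]; norm_num]
    apply log_le_log (by positivity)
    push_cast
    nlinarith
  exact ⟨h1, by rw [logFactor]; linarith⟩

theorem paduaBound_isBigO : paduaBound =O[atTop] fun n : ℕ => log n ^ 2 := by
  -- From `logFactor (n + 1) ≤ 4 log n` and `1 ≤ log n`: `48 · 4² + 2 = 770`. The constant `33 = 8 ·
  -- 4 + 1` for the grid arises likewise.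
  refine IsBigO.of_bound 770 ?_
  filter_upwards [eventually_ge_atTop 3] with n hn
  obtain ⟨h1, h2⟩ := one_le_log_and_logFactor_le hn
  rw [norm_of_nonneg (paduaBound_nonneg n), norm_of_nonneg (by positivity), paduaBound]
  nlinarith [logFactor_nonneg (n + 1)]

theorem gridBound_sq_isBigO : (fun n => gridBound n ^ 2) =O[atTop] fun n : ℕ => log n ^ 2 := by
  refine IsBigO.pow ?_ 2
  refine IsBigO.of_bound 33 ?_
  filter_upwards [eventually_ge_atTop 3] with n hn
  obtain ⟨h1, h2⟩ := one_le_log_and_logFactor_le hn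
  rw [norm_of_nonneg (gridBound_nonneg n), norm_of_nonneg (by positivity), gridBound]
  linarith

theorem nearBest_paduaPoints {n : ℕ} (hn : 0 < n) (α : C(Square, ℝ)) :
    (∃! p, IsInterpolant (totalDegreeSpace n) (paduaPoints n) α p) ∧
      (∃ q, IsBestApprox (totalDegreeSpace n) α q) ∧
      ∀ p q, IsInterpolant (totalDegreeSpace n) (paduaPoints n) α p →
        IsBestApprox (totalDegreeSpace n) α q →
        ‖α - polyFun p‖ ≤ (1 + paduaBound n) * ‖α - polyFun q‖ := by
  obtain ⟨hfin, hrank⟩ := finrank_totalDegreeSpace n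
  have himg := (Finset.finite_toSet ((range (n + 1) ×ˢ range (n + 2)).filter
    fun x => Even (x.1 + x.2))).image
    fun x : ℕ × ℕ => squarePoint (circleNode (2 * n) x.1) (circleNode (2 * (n + 1)) x.2)
  refine nearBest_of_lebesgue (himg.subset (paduaPoints_subset hn)) ?_
    (fun p hp M hM => norm_polyFun_le_paduaBound hn hp hM) α
  rw [hrank, ← card_even_eq_card_triangle, ← Set.ncard_coe_finset]
  exact (Set.ncard_le_ncard (paduaPoints_subset hn) himg).trans
    (Set.ncard_image_le (Finset.finite_toSet _))

theorem nearBest_chebyshevGrid {n : ℕ} (hn : 0 < n) (α : C(Square, ℝ)) :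
    (∃! p, IsInterpolant (maximalDegreeSpace n) (chebyshevGrid n) α p) ∧
      (∃ q, IsBestApprox (maximalDegreeSpace n) α q) ∧
      ∀ p q, IsInterpolant (maximalDegreeSpace n) (chebyshevGrid n) α p →
        IsBestApprox (maximalDegreeSpace n) α q →
        ‖α - polyFun p‖ ≤ (1 + gridBound n ^ 2) * ‖α - polyFun q‖ := by
  obtain ⟨hfin, hrank⟩ := finrank_maximalDegreeSpace n
  have himg := (Finset.finite_toSet (range (n + 1) ×ˢ range (n + 1))).image
    fun x : ℕ × ℕ => squarePoint (circleNode (2 * n) x.1) (circleNode (2 * n) x.2)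
  refine nearBest_of_lebesgue (himg.subset (chebyshevGrid_subset hn)) ?_
    (fun p hp M hM => norm_polyFun_le_gridBound hn hp hM) α
  rw [hrank, ← Set.ncard_coe_finset]
  exact (Set.ncard_le_ncard (chebyshevGrid_subset hn) himg).trans
    (Set.ncard_image_le (Finset.finite_toSet _))

end NearBest

end

theorem mainTheorem2 :
    (∃ ε : ℕ → ℝ, ε =O[atTop] (fun n : ℕ => Real.log (n : ℝ) ^ 2) ∧
      ∀ n : ℕ, 1 ≤ n → ∀ α : C(NearBest.Square, ℝ),
        (∃! p, NearBest.IsInterpolant (NearBest.totalDegreeSpace n) (NearBest.paduaPoints n) α p) ∧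
        (∃ q, NearBest.IsBestApprox (NearBest.totalDegreeSpace n) α q) ∧
        ∀ p q,
          NearBest.IsInterpolant (NearBest.totalDegreeSpace n) (NearBest.paduaPoints n) α p →
          NearBest.IsBestApprox (NearBest.totalDegreeSpace n) α q →
          ‖α - NearBest.polyFun p‖ ≤ (1 + ε n) * ‖α - NearBest.polyFun q‖) ∧
    (∃ ε : ℕ → ℝ, ε =O[atTop] (fun n : ℕ => Real.log (n : ℝ) ^ 2) ∧
      ∀ n : ℕ, 1 ≤ n → ∀ α : C(NearBest.Square, ℝ),
        (∃! p, NearBest.IsInterpolant (NearBest.maximalDegreeSpace n)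
          (NearBest.chebyshevGrid n) α p) ∧
        (∃ q, NearBest.IsBestApprox (NearBest.maximalDegreeSpace n) α q) ∧
        ∀ p q,
          NearBest.IsInterpolant (NearBest.maximalDegreeSpace n) (NearBest.chebyshevGrid n) α p →
          NearBest.IsBestApprox (NearBest.maximalDegreeSpace n) α q →
          ‖α - NearBest.polyFun p‖ ≤ (1 + ε n) * ‖α - NearBest.polyFun q‖) := by
  refine ⟨⟨NearBest.paduaBound, NearBest.paduaBound_isBigO, fun n hn α =>
    NearBest.nearBest_paduaPoints hn α⟩, ⟨fun n => NearBest.gridBound n ^ 2,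
    NearBest.gridBound_sq_isBigO, fun n hn α => NearBest.nearBest_chebyshevGrid hn α⟩⟩
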